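/- **Proposition (Logarithm law for contiguous systems).** Let $V$ be a finite set of spins-$\tfrac12$ and let $H=\sum_{\{a,b\}\subset V}h_{a,b}$ be a two-local Hamiltonian on $(\mathbb C^2)^{\otimes V}$ whose terms $h_{a,b}$ are Hermitian with lowest eigenvalue $0$. The interaction graph $G$ of $H$ has vertex set $V$ and an edge $\{a,b\}$ whenever $h_{a,b}\neq 0$. Assume that $H$ is *natural*, i.e. $G$ is connected and for each edge $\{a,b\}$ of $G$ there is an entangled (non-product) vector in $\mathbb C^2\otimes\mathbb C^2$ orthogonal to $\ker h_{a,b}$, and that $H$ is *unfrustrated*, i.e. $h_{a,b}|\Phi\rangle=0$ for every $\{a,b\}$ and every $|\Phi\rangle$ in the eigenspace $M$ of the lowest eigenvalue of $H$. Let $\rho$ be the maximally mixed state on $M$. For $A\subset V$ let $\partial A$ be the set of edges of $G$ between $A$ and $V\setminus A$, and call $A$ *contiguous* if any two spins of $A$ are joined by a path of $G$ inside $A$. Let $E_F(\rho)$ be the entanglement of formation of $\rho$ with respect to $A$ and $V\setminus A$, i.e. the infimum of $\sum_i p_i\,S(\mathrm{tr}_{V\setminus A}|\psi_i\rangle\langle\psi_i|)$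 over all decompositions $\rho=\sum_i p_i|\psi_i\rangle\langle\psi_i|$ into finitely many pure states, where $S$ is the von Neumann entropy; all logarithms are to base $2$. (1) For all $c,K>0$ there is a constant $C>0$, depending only on $c$ and $K$, with the following property. Let $H$ be as above, and suppose that its lattice satisfies $|\partial A|\ge K\min(|A|,|V\setminus A|)^c$ for every contiguous $A\subset V$. Then for every contiguous $A\subset V$ $$E_F(\rho)\le C\log|\partial A|\quad\text{if } |\partial A|\ge 2,\qquad\text{and in all cases}\quad E_F(\rho)\le C\log(|\partial A|+1).$$ (2) In particular, for each $d\ge 2$ there is a constant $C>0$ such that both bounds hold for every $n$, every $H$ as above whose interaction graph is the cubic lattice $\{1,\dots,n\}^d$ with nearest-neighbor edges, and every contiguous $A$. -/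

import Mathlib

open scoped Matrix ComplexOrder

noncomputable section

namespace SpinLattice

/-- The space `(ℂ²)^{⊗ V}` of pure states of a finite set `V` of spins-1/2, in the standard basis
indexed by the configurations `V → Fin 2`. -/
abbrev StateSpace (V : Type*) [Fintype V] [DecidableEq V] : Type _ :=
  EuclideanSpace ℂ (V → Fin 2)

/-- The operator on all the spins that acts as `h` on the (ordered) pair of distinct spins `(a, b)`
and as the identity on the other spins. -/
def embed {V : Type*} [Fintype V] [DecidableEq V] (a b : V)
    (h : Matrix (Fin 2 × Fin 2) (Fin 2 × Fin 2) ℂ) : Matrix (V → Fin 2) (V → Fin 2) ℂ :=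
  fun x y => if ∀ v, v ≠ a → v ≠ b → x v = y v then h (x a, x b) (y a, y b) else 0

/-- A two-spin vector is entangled if it is not a product vector. -/
def IsEntangled (β : Fin 2 × Fin 2 → ℂ) : Prop :=
  ¬ ∃ f g : Fin 2 → ℂ, ∀ i j, β (i, j) = f i * g j

/-- A two-local Hamiltonian on the spins `V`, given by its list of two-spin terms, each of which
has ground energy zero. `term a b` and `term b a` are the same term of the pair `{a, b}`, written
for the two orders of its spins; pairs that do not interact have the term `0`. -/
structure Hamiltonian (V : Type*) [Fintype V] [DecidableEq V] where
  /-- the term of the pair `{a, b}` -/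
  term : V → V → Matrix (Fin 2 × Fin 2) (Fin 2 × Fin 2) ℂ
  term_self : ∀ a, term a a = 0
  term_symm : ∀ a b, term b a = (term a b).submatrix Prod.swap Prod.swap
  posSemidef : ∀ a b, (term a b).PosSemidef
  ground_energy_zero : ∀ a b, ∃ φ : Fin 2 × Fin 2 → ℂ, φ ≠ 0 ∧ term a b *ᵥ φ = 0

/-- `∂A`: the edges of `G` between `A` and its complement. -/
def edgeBoundary {V : Type*} (G : SimpleGraph V) (A : Finset V) : Set (Sym2 V) :=
  {e | ∃ a ∈ A, ∃ b ∉ A, G.Adj a b ∧ e = s(a, b)}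

/-- `|∂A|`. -/
def boundaryArea {V : Type*} (G : SimpleGraph V) (A : Finset V) : ℕ :=
  (edgeBoundary G A).ncard

/-- Any two spins of `A` are joined by a path in `A`. -/
def IsContiguous {V : Type*} (G : SimpleGraph V) (A : Finset V) : Prop :=
  (G.induce (A : Set V)).Preconnected

/-- The lattice constants: the boundary of a contiguous region grows at least like `K` times the
`c`-th power of its size. As `V` is finite, the size of a region is measured by the smaller of the
region and its complement. -/
def HasBoundaryGrowth {V : Type*} [Fintype V] [DecidableEq V] (G : SimpleGraph V) (c K : ℝ) :
    Prop :=
  ∀ A : Finset V, IsContiguous G A →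
    K * ((min A.card Aᶜ.card : ℕ) : ℝ) ^ c ≤ (boundaryArea G A : ℝ)

/-- The cubic lattice of side `n` in dimension `d`, with open boundary: the neighbors of a site are
the sites at `ℓ¹`-distance one. -/
def cubicLattice (d n : ℕ) : SimpleGraph (Fin d → Fin n) where
  Adj x y := ∑ i, Nat.dist (x i) (y i) = 1
  symm := ⟨fun x y h => by simpa [Nat.dist_comm] using h⟩
  loopless := ⟨fun x h => by simp at h⟩

namespace Hamiltonian

variable {V : Type*} [Fintype V] [DecidableEq V] (H : Hamiltonian V)

/-- The graph of the pairs of spins with a non-zero term. -/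
def interactionGraph : SimpleGraph V where
  Adj a b := H.term a b ≠ 0
  symm := ⟨fun a b h h' => h (by rw [H.term_symm b a, h']; rfl)⟩
  loopless := ⟨fun a h => h (H.term_self a)⟩

/-- The term of the pair `{a, b}` as an operator on all the spins. -/
def termOp (a b : V) : Matrix (V → Fin 2) (V → Fin 2) ℂ := embed a b (H.term a b)

/-- The Hamiltonian as an operator: the sum of its terms over unordered pairs of spins. (The sum
over ordered pairs counts each term twice.) -/
def op : Matrix (V → Fin 2) (V → Fin 2) ℂ := (1 / 2 : ℂ) • ∑ a, ∑ b, H.termOp a b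

/-- The lowest eigenvalue of the Hamiltonian. -/
def groundEnergy : ℝ :=
  sInf {E : ℝ | Module.End.HasEigenvalue (Matrix.toEuclideanLin H.op) (E : ℂ)}

/-- The ground state manifold. -/
def groundSpace : Submodule ℂ (StateSpace V) :=
  Module.End.eigenspace (Matrix.toEuclideanLin H.op) (H.groundEnergy : ℂ)

/-- Every ground state vector is a ground state (of energy zero) of each of the terms. -/
def IsUnfrustrated : Prop :=
  ∀ ψ ∈ H.groundSpace, ∀ a b, Matrix.toEuclideanLin (H.termOp a b) ψ = 0

/-- There are no isolated subsystems, and each interaction term has an entangled excited state,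
i.e. there is an entangled vector orthogonal to the ground space of the term. -/
def IsNatural : Prop :=
  H.interactionGraph.Connected ∧
    ∀ a b, H.interactionGraph.Adj a b →
      ∃ β : Fin 2 × Fin 2 → ℂ, IsEntangled β ∧
        ∀ φ : Fin 2 × Fin 2 → ℂ, H.term a b *ᵥ φ = 0 → star β ⬝ᵥ φ = 0

/-- The ground state: the maximally mixed state over the ground state manifold. -/
def groundState : Matrix (V → Fin 2) (V → Fin 2) ℂ :=
  ((Module.finrank ℂ H.groundSpace : ℂ)⁻¹) •
    Matrix.toEuclideanLin.symm (H.groundSpace.starProjection : StateSpace V →ₗ[ℂ] StateSpace V)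

end Hamiltonian

section Entanglement

variable {V : Type*} [Fintype V] [DecidableEq V]

/-- The coefficients of a state vector, as a matrix whose rows are indexed by the configurations
of `A` and whose columns are indexed by the configurations of the complement of `A`. -/
def coeffMatrix (A : Finset V) (ψ : StateSpace V) :
    Matrix ({v // v ∈ A} → Fin 2) ({v // v ∉ A} → Fin 2) ℂ :=
  fun x y => ψ ((Equiv.piEquivPiSubtypeProd (· ∈ A) (fun _ => Fin 2)).symm (x, y))

/-- The reduced density matrix on `A` of a state vector: the partial trace of `|ψ⟩⟨ψ|` over the
complement of `A`. -/
def reducedDensity (A : Finset V) (ψ : StateSpace V) :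
    Matrix ({v // v ∈ A} → Fin 2) ({v // v ∈ A} → Fin 2) ℂ :=
  coeffMatrix A ψ * (coeffMatrix A ψ)ᴴ

theorem reducedDensity_isHermitian (A : Finset V) (ψ : StateSpace V) :
    (reducedDensity A ψ).IsHermitian :=
  Matrix.isHermitian_mul_conjTranspose_self _

/-- The entanglement entropy of a pure state with respect to `A` and its complement, in e-bits:
the von Neumann entropy `- tr ρ_A log₂ ρ_A` of the reduced state. -/
def entanglementEntropy (A : Finset V) (ψ : StateSpace V) : ℝ :=
  -∑ i, (reducedDensity_isHermitian A ψ).eigenvalues i *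
    Real.logb 2 ((reducedDensity_isHermitian A ψ).eigenvalues i)

/-- The entanglement of formation of a density matrix with respect to `A` and its complement: the
infimum, over all finite decompositions into pure states, of the mean entanglement entropy. -/
def entanglementOfFormation (A : Finset V) (ρ : Matrix (V → Fin 2) (V → Fin 2) ℂ) : ℝ :=
  sInf {E : ℝ | ∃ (m : ℕ) (p : Fin m → ℝ) (ψ : Fin m → StateSpace V),
    (∀ i, 0 ≤ p i) ∧ ∑ i, p i = 1 ∧ (∀ i, ‖ψ i‖ = 1) ∧
    ρ = ∑ i, (p i : ℂ) • Matrix.vecMulVec (ψ i) (star (ψ i : (V → Fin 2) → ℂ)) ∧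
    E = ∑ i, p i * entanglementEntropy A (ψ i)}

end Entanglement

end SpinLattice

end

/-! Ground states have Schmidt rank at most `min |A| |Aᶜ| + 1`, and boundary growth turns the
logarithm of this number into the logarithm of `|∂A|`.

On an edge, an entangled `β` orthogonal to the kernel of the term becomes the singlet after
invertible changes of basis on the two spins. If the basis at one end is given, the basis at the
other end can be solved for. Doing so along a spanning tree of the connected graph gives one
invertible `M v` per spin, and every tree constraint becomes invariance under exchanging the two
ends (`localOp_mulVec_comp_swap`). These exchanges generate all permutations, so each ground state
is a product of one-spin operators applied to a function of the number of up spins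
(`exists_localOp_mulVec_weight`). One-spin operators do not raise the Schmidt rank, and the
coefficient matrix of a function of `weight x + weight y` has at most `|A| + 1` distinct rows and
`|Aᶜ| + 1` distinct columns.

An orthonormal basis of the ground space is an admissible decomposition of the ground state, so its
mean entropy bounds the entanglement of formation (`entanglementOfFormation_groundState_le`).

For the cubic lattice, the growth exponent `1/2` suffices. A projection argument gives it for small
regions and a count of coordinate routes for large ones (`card_le_mul_boundaryArea_sq`). -/

open scoped Matrix ComplexOrder

noncomputable section

namespace SpinLattice

/-! ### Two-spin terms, one-spin operators and the singlet. -/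

section LocalOperators

section

variable {V : Type*} [DecidableEq V]

/-- The configuration `x` with the spins `a` and `b` set to `p.1` and `p.2`. -/
def setPair (x : V → Fin 2) (a b : V) (p : Fin 2 × Fin 2) : V → Fin 2 :=
  Function.update (Function.update x a p.1) b p.2

theorem setPair_left {a b : V} (hab : a ≠ b) (x : V → Fin 2) (p : Fin 2 × Fin 2) :
    setPair x a b p a = p.1 := by
  simp [setPair, Function.update_of_ne hab]

theorem setPair_right (a b : V) (x : V → Fin 2) (p : Fin 2 × Fin 2) :
    setPair x a b p b = p.2 := by
  simp [setPair]

theorem setPair_of_ne {a b v : V} (ha : v ≠ a) (hb : v ≠ b) (x : V → Fin 2)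
    (p : Fin 2 × Fin 2) : setPair x a b p v = x v := by
  simp [setPair, ha, hb]

theorem setPair_setPair {a b : V} (x : V → Fin 2) (p q : Fin 2 × Fin 2) :
    setPair (setPair x a b p) a b q = setPair x a b q := by
  ext v
  by_cases hb : v = b
  · subst hb; simp [setPair]
  · by_cases ha : v = a
    · subst ha; simp [setPair, hb]
    · simp [setPair, ha, hb]

end

variable {V : Type*} [Fintype V] [DecidableEq V]

theorem sum_ite_eq_off_pair {M : Type*} [AddCommMonoid M] {a b : V} (hab : a ≠ b)
    (x : V → Fin 2) (F : (V → Fin 2) → M) :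
    ∑ y, (if ∀ v, v ≠ a → v ≠ b → x v = y v then F y else 0) =
      ∑ p : Fin 2 × Fin 2, F (setPair x a b p) := by
  rw [← Finset.sum_filter]
  symm
  refine Finset.sum_nbij' (fun p => setPair x a b p) (fun y => (y a, y b)) ?_ ?_ ?_ ?_ ?_
  · intro p _
    simp only [Finset.mem_filter, Finset.mem_univ, true_and]
    intro v ha hb
    exact (setPair_of_ne ha hb x p).symm
  · simp
  · intro p _
    simp [setPair_left hab, setPair_right]
  · intro y hy
    simp only [Finset.mem_filter, Finset.mem_univ, true_and] at hy
    ext v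
    by_cases hb : v = b
    · subst hb; simp [setPair]
    · by_cases ha : v = a
      · subst ha; simp [setPair, hb]
      · simp [setPair, ha, hb, hy v ha hb]
  · simp

/-- `embed a b h` is block diagonal over the configurations of the other spins, and every block is
`h`. -/
theorem embed_mulVec_setPair {a b : V} (hab : a ≠ b)
    (h : Matrix (Fin 2 × Fin 2) (Fin 2 × Fin 2) ℂ) (ψ : (V → Fin 2) → ℂ) (x : V → Fin 2)
    (p : Fin 2 × Fin 2) :
    (embed a b h *ᵥ ψ) (setPair x a b p) = (h *ᵥ fun q => ψ (setPair x a b q)) p := by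
  have h1 := sum_ite_eq_off_pair hab (setPair x a b p)
    (fun y => h p (y a, y b) * ψ y)
  simp only [setPair_setPair, setPair_left hab, setPair_right] at h1
  simp only [Matrix.mulVec, dotProduct, embed, setPair_left hab, setPair_right, ite_mul, zero_mul]
  exact h1

/-- A sum over configurations vanishes if its partial sums over two of the spins do. -/
theorem sum_eq_zero_of_sum_setPair {a b : V} (hab : a ≠ b) (F : (V → Fin 2) → ℂ)
    (hF : ∀ x, ∑ p, F (setPair x a b p) = 0) : ∑ y, F y = 0 := by
  have h1 : ∑ x : V → Fin 2, ∑ y, (if ∀ v, v ≠ a → v ≠ b → x v = y v then F y else 0) = 0 :=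
    Finset.sum_eq_zero fun x _ => by rw [sum_ite_eq_off_pair hab, hF]
  rw [Finset.sum_comm] at h1
  -- Each `y` agrees off the pair with exactly four configurations, so the double sum is four times
  -- the sum.
  have h2 : ∀ y : V → Fin 2,
      ∑ x : V → Fin 2, (if ∀ v, v ≠ a → v ≠ b → x v = y v then F y else 0) = 4 * F y := by
    intro y
    have := sum_ite_eq_off_pair hab y (fun _ => F y)
    simp only [eq_comm (a := y _)] at this
    rw [this]
    simp [Fintype.card_prod]
  simp only [h2, ← Finset.mul_sum] at h1
  simpa using h1

/-- The tensor product of one-spin operators. -/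
def localOp {ι : Type*} [Fintype ι] (M : ι → Matrix (Fin 2) (Fin 2) ℂ) :
    Matrix (ι → Fin 2) (ι → Fin 2) ℂ :=
  fun x y => ∏ v, M v (x v) (y v)

theorem localOp_mul (M N : V → Matrix (Fin 2) (Fin 2) ℂ) :
    localOp M * localOp N = localOp fun v => M v * N v := by
  ext x y
  simp only [localOp, Matrix.mul_apply, Finset.prod_univ_sum, Fintype.piFinset_univ,
    Finset.prod_mul_distrib]

theorem localOp_one {ι : Type*} [Fintype ι] :
    localOp (fun _ : ι => (1 : Matrix (Fin 2) (Fin 2) ℂ)) = 1 := by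
  ext x y
  simp only [localOp, Matrix.one_apply, Finset.prod_ite_zero, Finset.prod_const_one,
    Finset.mem_univ, true_imp_iff, funext_iff]

/-- If a state is orthogonal to the two-spin vector which the one-spin operators `M a` and `M b`
map to the singlet, then its image under the tensor product of the `M v` is invariant under the
exchange of `a` and `b`. -/
theorem localOp_mulVec_comp_swap {a b : V} (hab : a ≠ b) (M : V → Matrix (Fin 2) (Fin 2) ℂ)
    (B : Matrix (Fin 2) (Fin 2) ℂ)
    (hB : ∀ i j, B i j = M a 0 i * M b 1 j - M a 1 i * M b 0 j) (ψ : (V → Fin 2) → ℂ)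
    (hψ : ∀ x, ∑ p : Fin 2 × Fin 2, B p.1 p.2 * ψ (setPair x a b p) = 0) (x : V → Fin 2) :
    (localOp M *ᵥ ψ) (x ∘ Equiv.swap a b) = (localOp M *ᵥ ψ) x := by
  have hb : b ∈ (Finset.univ : Finset V).erase a := by simp [hab.symm]
  set g : (V → Fin 2) → ℂ := fun y =>
    ∏ v ∈ ((Finset.univ : Finset V).erase a).erase b, M v (x v) (y v) with hg
  have split : ∀ f : V → ℂ, ∏ v, f v =
      f a * (f b * ∏ v ∈ ((Finset.univ : Finset V).erase a).erase b, f v) := by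
    intro f
    rw [Finset.mul_prod_erase _ f hb, Finset.mul_prod_erase _ f (Finset.mem_univ a)]
  have hg' : ∀ y, ∏ v ∈ ((Finset.univ : Finset V).erase a).erase b,
      M v ((x ∘ Equiv.swap a b) v) (y v) = g y := by
    intro y
    refine Finset.prod_congr rfl fun v hv => ?_
    simp only [Finset.mem_erase, Finset.mem_univ, and_true] at hv
    simp [Equiv.swap_apply_of_ne_of_ne hv.2 hv.1]
  -- The left side is antisymmetric in the two spin values `x a`, `x b`, and antisymmetric forms on
  -- `ℂ²` are multiples of the singlet; here `s` is 0 or ±1.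
  have hs : ∃ s : ℂ, ∀ i j,
      M a (x b) i * M b (x a) j - M a (x a) i * M b (x b) j = s * B i j := by
    have key : ∀ k l : Fin 2, ∃ s : ℂ, ∀ i j,
        M a l i * M b k j - M a k i * M b l j = s * B i j := by
      intro k l
      fin_cases k <;> fin_cases l
      · exact ⟨0, fun i j => by simp⟩
      · exact ⟨-1, fun i j => by simp [hB]⟩
      · exact ⟨1, fun i j => by simp [hB]⟩
      · exact ⟨0, fun i j => by simp⟩
    exact key _ _
  obtain ⟨s, hs⟩ := hs
  rw [← sub_eq_zero]
  have h1 : (localOp M *ᵥ ψ) (x ∘ Equiv.swap a b) - (localOp M *ᵥ ψ) x =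
      ∑ y, s * (g y * (B (y a) (y b) * ψ y)) := by
    simp only [Matrix.mulVec, dotProduct, localOp, ← Finset.sum_sub_distrib]
    refine Finset.sum_congr rfl fun y _ => ?_
    rw [split, split, hg']
    simp only [Function.comp_apply, Equiv.swap_apply_left, Equiv.swap_apply_right]
    change _ - M a (x a) (y a) * (M b (x b) (y b) * g y) * ψ y = _
    linear_combination (g y * ψ y) * hs (y a) (y b)
  rw [h1, ← Finset.mul_sum, sum_eq_zero_of_sum_setPair hab _ ?_, mul_zero]
  intro z
  have hgz : ∀ p, g (setPair z a b p) = g z := by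
    intro p
    refine Finset.prod_congr rfl fun v hv => ?_
    simp only [Finset.mem_erase, Finset.mem_univ, and_true] at hv
    rw [setPair_of_ne hv.2 hv.1]
  simp only [hgz, setPair_left hab, setPair_right, ← Finset.mul_sum, hψ, mul_zero]

/-- The relation reads `B = Nᵀ ε N'` with `ε` the antisymmetric matrix of the singlet, so it can be
solved for `N'`. This is the step from a parent to its child in the tree. -/
theorem exists_singlet_frame (N B : Matrix (Fin 2) (Fin 2) ℂ) (hN : N.det ≠ 0) (hB : B.det ≠ 0) :
    ∃ N' : Matrix (Fin 2) (Fin 2) ℂ, N'.det ≠ 0 ∧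
      ∀ i j, B i j = N 0 i * N' 1 j - N 1 i * N' 0 j := by
  set E : Matrix (Fin 2) (Fin 2) ℂ := Nᵀ * !![0, 1; -1, 0] with hE
  have hdet : IsUnit E.det := by
    simp [hE, Matrix.det_mul, Matrix.det_fin_two_of, hN]
  refine ⟨E⁻¹ * B, ?_, fun i j => ?_⟩
  · rw [Matrix.det_mul, Matrix.det_nonsing_inv]
    exact mul_ne_zero (by simpa using hdet.ne_zero) hB
  · have h := congrFun (congrFun (Matrix.mul_nonsing_inv_cancel_left E B hdet) i) j
    rw [← h]
    generalize E⁻¹ * B = N'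
    simp [hE, Matrix.mul_apply, Fin.sum_univ_two]
    ring

/-- A singular 2×2 matrix has rank at most one and so factors through one row and one column. The
conjugate appears because orthogonality pairs a state with `star β`. -/
theorem IsEntangled.det_ne_zero {β : Fin 2 × Fin 2 → ℂ} (h : IsEntangled β) :
    (Matrix.of fun i j => star (β (i, j))).det ≠ 0 := by
  intro h0
  apply h
  have hd : β (0, 0) * β (1, 1) = β (0, 1) * β (1, 0) := by
    rw [Matrix.det_fin_two] at h0
    have := congrArg star h0
    simp at this
    linear_combination this
  by_cases hz : ∀ i j, β (i, j) = 0
  · exact ⟨0, 0, fun i j => by simp [hz]⟩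
  · push Not at hz
    obtain ⟨i₀, j₀, h₀⟩ := hz
    refine ⟨fun i => β (i, j₀), fun j => β (i₀, j) / β (i₀, j₀), fun i j => ?_⟩
    field_simp
    revert h₀
    fin_cases i₀ <;> fin_cases j₀ <;> fin_cases i <;> fin_cases j <;> intro h₀ <;>
      simp <;> first | ring1 | linear_combination hd | linear_combination -hd

end LocalOperators

/-! ### Propagation along a rooted tree, and permutation invariance. -/

section Frames

variable {V : Type*}

/-- Well-founded recursion on `f`: the value at `v` is chosen from the value at its parent `p v`,
starting from `b₀` at the root. -/
theorem exists_rec_of_rank {α β : Type*} (f : α → ℕ) (r : α) (p : α → α)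
    (hp : ∀ v, v ≠ r → f (p v) < f v) (R : α → β → β → Prop) (b₀ : β)
    (hR : ∀ v, v ≠ r → ∀ N, ∃ N', R v N N') :
    ∃ M : α → β, ∀ v, v ≠ r → R v (M (p v)) (M v) := by
  classical
  have hR' : ∀ v N, ∃ N', v ≠ r → R v N N' := fun v N => by
    by_cases h : v = r
    · exact ⟨b₀, fun h' => absurd h h'⟩
    · obtain ⟨N', h'⟩ := hR v h N
      exact ⟨N', fun _ => h'⟩
  choose step hstep using hR'
  let M : α → β := (measure f).wf.fix fun v ih =>
    if h : v = r then b₀ else step v (ih (p v) (hp v h))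
  refine ⟨M, fun v hv => ?_⟩
  have : M v = step v (M (p v)) := by
    change (measure f).wf.fix _ v = _
    rw [WellFounded.fix_eq, dif_neg hv]
  rw [this]
  exact hstep v _ hv

theorem exists_adj_dist_lt {G : SimpleGraph V} (hG : G.Connected) (r v : V) (hv : v ≠ r) :
    ∃ u, G.Adj u v ∧ G.dist r u < G.dist r v := by
  obtain ⟨p, hp⟩ := hG.exists_walk_length_eq_dist v r
  cases p with
  | nil => exact absurd rfl hv
  | cons h q =>
    rename_i u
    refine ⟨u, h.symm, ?_⟩
    rw [SimpleGraph.dist_comm, SimpleGraph.dist_comm (u := r) (v := v), ← hp,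
      SimpleGraph.Walk.length_cons]
    exact Nat.lt_succ_of_le (SimpleGraph.dist_le q)

/-- A function of configurations which is invariant under the exchanges along the edges of a
rooted tree is invariant under all permutations. -/
theorem comp_perm_eq_of_parent [Finite V] [DecidableEq V] {β : Type*} (f : V → ℕ) (r : V) (p : V → V)
    (hp : ∀ v, v ≠ r → f (p v) < f v) (φ : (V → Fin 2) → β)
    (h : ∀ v, v ≠ r → ∀ x, φ (x ∘ Equiv.swap (p v) v) = φ x)
    (σ : Equiv.Perm V) (x : V → Fin 2) : φ (x ∘ σ) = φ x := by
  -- Conjugation, `(a c) = (a b)(b c)(a b)`, chains exchanges along tree paths.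
  have conj : ∀ a b c : V, (∀ x, φ (x ∘ Equiv.swap a b) = φ x) →
      (∀ x, φ (x ∘ Equiv.swap b c) = φ x) → ∀ x, φ (x ∘ Equiv.swap a c) = φ x := by
    intro a b c h1 h2 x
    by_cases hac : a = c
    · subst hac; simp [Equiv.swap_self]
    by_cases hbc : b = c
    · subst hbc; exact h1 x
    have e : Equiv.swap a c = Equiv.swap a b * Equiv.swap b c * Equiv.swap a b := by
      rw [← Equiv.swap_mul_swap_mul_swap (Ne.symm hbc) (Ne.symm hac), Equiv.swap_comm b a,
        Equiv.swap_comm c b]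
    rw [e]
    have : x ∘ ⇑(Equiv.swap a b * Equiv.swap b c * Equiv.swap a b) =
        ((x ∘ Equiv.swap a b) ∘ Equiv.swap b c) ∘ Equiv.swap a b := rfl
    rw [this, h1, h2, h1]
  have root : ∀ n v, f v ≤ n → ∀ x, φ (x ∘ Equiv.swap r v) = φ x := by
    intro n
    induction n with
    | zero =>
      intro v hv x
      by_cases hvr : v = r
      · subst hvr; simp [Equiv.swap_self]
      · have := hp v hvr; omega
    | succ n ih =>
      intro v hv
      by_cases hvr : v = r
      · subst hvr; simp [Equiv.swap_self]
      · exact conj r (p v) v (ih _ (by have := hp v hvr; omega)) (h v hvr)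
  have all : ∀ a b x, φ (x ∘ Equiv.swap a b) = φ x := fun a b =>
    conj a r b (by rw [Equiv.swap_comm]; exact root _ a le_rfl) (root _ b le_rfl)
  induction σ using Equiv.Perm.swap_induction_on generalizing x with
  | one => rfl
  | swap_mul σ a b _ ih =>
    have : x ∘ ⇑(Equiv.swap a b * σ) = (x ∘ Equiv.swap a b) ∘ σ := rfl
    rw [this, ih, all]

/-- The number of spins that are up. -/
def weight {ι : Type*} [Fintype ι] (x : ι → Fin 2) : ℕ := ∑ v, (x v : ℕ)

theorem exists_perm_of_weight_eq [Fintype V] {x y : V → Fin 2} (h : weight x = weight y) :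
    ∃ σ : Equiv.Perm V, y ∘ σ = x := by
  have hw : ∀ z : V → Fin 2, weight z = Fintype.card {v // z v = 1} := by
    intro z
    rw [Fintype.card_subtype, Finset.card_filter]
    refine Finset.sum_congr rfl fun v _ => ?_
    generalize z v = i
    fin_cases i <;> rfl
  have hz : ∀ z : V → Fin 2, Fintype.card {v // z v = 0} = Fintype.card V - weight z := by
    intro z
    rw [hw, ← Fintype.card_subtype_compl]
    refine Fintype.card_congr (Equiv.subtypeEquivRight fun v => ?_)
    generalize z v = i
    fin_cases i <;> simp
  have e : ∀ c : Fin 2, Nonempty ({v // x v = c} ≃ {v // y v = c}) := by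
    intro c
    rw [← Fintype.card_eq]
    fin_cases c
    · exact (hz x).trans ((congrArg _ h).trans (hz y).symm)
    · exact (hw x).symm.trans (h.trans (hw y))
  exact ⟨Equiv.ofFiberEquiv fun c => (e c).some, funext fun v => Equiv.ofFiberEquiv_map _ v⟩

end Frames

/-! ### Normal form of the ground states. -/

section GroundSpace

variable {V : Type*} [Fintype V] [DecidableEq V]

/-- With the other spins fixed, the slice of `ψ` over the pair lies in the kernel of the term. -/
theorem Hamiltonian.IsUnfrustrated.sum_star_mul_eq_zero {H : Hamiltonian V}
    (hU : H.IsUnfrustrated) {a b : V} (hab : a ≠ b) {β : Fin 2 × Fin 2 → ℂ}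
    (hβ : ∀ φ : Fin 2 × Fin 2 → ℂ, H.term a b *ᵥ φ = 0 → star β ⬝ᵥ φ = 0)
    {ψ : StateSpace V} (hψ : ψ ∈ H.groundSpace) (x : V → Fin 2) :
    ∑ p : Fin 2 × Fin 2, star (β p) * ψ (setPair x a b p) = 0 := by
  refine hβ (fun p => ψ (setPair x a b p)) (funext fun p => ?_)
  rw [← embed_mulVec_setPair hab]
  have h := hU ψ hψ a b
  rw [Matrix.toLpLin_apply] at h
  have h' := congrArg (fun φ : StateSpace V => φ (setPair x a b p)) h
  simpa [Hamiltonian.termOp] using h'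

/-- The ground states of a natural unfrustrated Hamiltonian are obtained from permutation
invariant vectors by a tensor product of one-spin operators. -/
theorem exists_localOp_mulVec_weight {H : Hamiltonian V} (hN : H.IsNatural)
    (hU : H.IsUnfrustrated) :
    ∃ N : V → Matrix (Fin 2) (Fin 2) ℂ, ∀ ψ ∈ H.groundSpace, ∃ F : ℕ → ℂ,
      (ψ : (V → Fin 2) → ℂ) = localOp N *ᵥ fun x => F (weight x) := by
  obtain ⟨hG, hE⟩ := hN
  obtain ⟨r⟩ := hG.nonempty
  choose! β hent hβ using hE
  have hpar : ∀ v, ∃ u, v ≠ r → H.interactionGraph.Adj u v ∧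
      H.interactionGraph.dist r u < H.interactionGraph.dist r v := by
    intro v
    by_cases h : v = r
    · exact ⟨r, fun h' => absurd h h'⟩
    · obtain ⟨u, hu⟩ := exists_adj_dist_lt hG r v h
      exact ⟨u, fun _ => hu⟩
  choose p hp using hpar
  -- Only the edges to parents, which are nearer to `r`, constrain the frames, so cycles of the
  -- graph raise no consistency question. The root gets the identity.
  obtain ⟨M, hM⟩ := exists_rec_of_rank (β := {N : Matrix (Fin 2) (Fin 2) ℂ // N.det ≠ 0})
    (H.interactionGraph.dist r) r p (fun v hv => (hp v hv).2)
    (fun v N N' => ∀ i j, star (β (p v) v (i, j)) =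
      N.1 0 i * N'.1 1 j - N.1 1 i * N'.1 0 j) ⟨1, by simp⟩ (fun v hv N => by
      obtain ⟨N', h1, h2⟩ := exists_singlet_frame N.1 _ N.2
        (hent _ _ (hp v hv).1).det_ne_zero
      exact ⟨⟨N', h1⟩, h2⟩)
  refine ⟨fun v => (M v).1⁻¹, fun ψ hψ => ?_⟩
  set φ : (V → Fin 2) → ℂ := localOp (fun v => (M v).1) *ᵥ ψ with hφ
  have hsymm : ∀ (σ : Equiv.Perm V) x, φ (x ∘ σ) = φ x := by
    refine comp_perm_eq_of_parent (H.interactionGraph.dist r) r p (fun v hv => (hp v hv).2) φ ?_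
    intro v hv x
    have hadj := (hp v hv).1
    exact localOp_mulVec_comp_swap hadj.ne (fun v => (M v).1)
      (Matrix.of fun i j => star (β (p v) v (i, j))) (hM v hv) ψ
      (fun z => hU.sum_star_mul_eq_zero hadj.ne (hβ _ _ hadj) hψ z) x
  have hw : ∀ x y, weight x = weight y → φ x = φ y := by
    intro x y h
    obtain ⟨σ, rfl⟩ := exists_perm_of_weight_eq h
    exact hsymm σ y
  refine ⟨Function.extend weight φ 0, ?_⟩
  have hF : (fun x : V → Fin 2 => Function.extend weight φ 0 (weight x)) = φ := by
    funext x
    exact Function.FactorsThrough.extend_apply (fun x y h => hw x y h) 0 x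
  rw [hF, hφ, Matrix.mulVec_mulVec, localOp_mul]
  have h1 : (fun v => (M v).1⁻¹ * (M v).1) = fun _ => 1 :=
    funext fun v => Matrix.nonsing_inv_mul _ (isUnit_iff_ne_zero.2 (M v).2)
  rw [h1, localOp_one, Matrix.one_mulVec]

end GroundSpace

/-! ### Schmidt rank across the cut. -/

section SchmidtRank

/-- Rows indexed through `Fin k` make the matrix factor through a space of dimension `k`. -/
theorem rank_le_of_row_eq {m n : Type*} [Fintype m] [Fintype n] [DecidableEq m] {k : ℕ}
    (w : m → Fin k) (f : Matrix (Fin k) n ℂ) :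
    (Matrix.of fun i j => f (w i) j).rank ≤ k := by
  have h : (Matrix.of fun i j => f (w i) j) =
      (Matrix.of fun i l => if w i = l then (1 : ℂ) else 0) * f := by
    ext i j
    simp [Matrix.mul_apply]
  rw [h]
  exact (Matrix.rank_mul_le_right _ f).trans ((Matrix.rank_le_card_height f).trans (by simp))

theorem weight_lt {ι : Type*} [Fintype ι] (x : ι → Fin 2) : weight x < Fintype.card ι + 1 := by
  have : weight x ≤ ∑ _v : ι, 1 := Finset.sum_le_sum fun v _ => Nat.le_of_lt_succ (x v).isLt
  simp at this
  omega

variable {V : Type*} [Fintype V] [DecidableEq V]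

theorem coeffMatrix_localOp_mulVec (A : Finset V) (N : V → Matrix (Fin 2) (Fin 2) ℂ)
    (φ : StateSpace V) :
    coeffMatrix A (WithLp.toLp 2 (localOp N *ᵥ φ)) =
      localOp (fun v : {v // v ∈ A} => N v) * coeffMatrix A φ *
        (localOp fun v : {v // v ∉ A} => N v)ᵀ := by
  ext x y
  simp only [coeffMatrix, Matrix.mulVec, dotProduct, Matrix.mul_apply, Matrix.transpose_apply]
  rw [← (Equiv.piEquivPiSubtypeProd (· ∈ A) (fun _ => Fin 2)).symm.sum_comp,
    Fintype.sum_prod_type_right]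
  refine Finset.sum_congr rfl fun y' _ => ?_
  rw [Finset.sum_mul]
  refine Finset.sum_congr rfl fun x' _ => ?_
  have h : localOp N ((Equiv.piEquivPiSubtypeProd (· ∈ A) (fun _ => Fin 2)).symm (x, y))
      ((Equiv.piEquivPiSubtypeProd (· ∈ A) (fun _ => Fin 2)).symm (x', y')) =
      localOp (fun v : {v // v ∈ A} => N v) x x' *
        localOp (fun v : {v // v ∉ A} => N v) y y' := by
    simp only [localOp]
    rw [← Fintype.prod_subtype_mul_prod_subtype (· ∈ A)]
    congr 1
    · refine Finset.prod_congr (by ext; simp) fun v _ => ?_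
      simp [v.2]
    · refine Finset.prod_congr (by ext; simp) fun v _ => ?_
      simp [v.2]
  rw [h]
  ring

theorem weight_piEquivPiSubtypeProd_symm (A : Finset V) (x : {v // v ∈ A} → Fin 2)
    (y : {v // v ∉ A} → Fin 2) :
    weight ((Equiv.piEquivPiSubtypeProd (· ∈ A) (fun _ => Fin 2)).symm (x, y)) =
      weight x + weight y := by
  simp only [weight]
  rw [← Fintype.sum_subtype_add_sum_subtype (· ∈ A)]
  congr 1
  · refine Finset.sum_congr (by ext; simp) fun v _ => ?_
    simp [v.2]
  · refine Finset.sum_congr (by ext; simp) fun v _ => ?_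
    simp [v.2]

theorem rank_coeffMatrix_weight_le (A : Finset V) (F : ℕ → ℂ) :
    (coeffMatrix A (WithLp.toLp 2 fun x => F (weight x))).rank ≤ min A.card Aᶜ.card + 1 := by
  have hA : Fintype.card {v // v ∈ A} = A.card := Fintype.card_coe A
  have hB : Fintype.card {v // v ∉ A} = Aᶜ.card := by
    rw [Fintype.card_subtype]
    congr 1
    ext v
    simp
  have h : coeffMatrix A (WithLp.toLp 2 fun x => F (weight x)) =
      Matrix.of fun x y => F (weight x + weight y) := by
    ext x y
    simp [coeffMatrix, weight_piEquivPiSubtypeProd_symm]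
  rw [h, ← min_add_add_right, le_min_iff, ← hA, ← hB]
  constructor
  · exact rank_le_of_row_eq (fun x => ⟨weight x, weight_lt x⟩)
      (Matrix.of fun k y => F (k + weight y))
  · rw [← Matrix.rank_transpose]
    exact rank_le_of_row_eq (fun y => ⟨weight y, weight_lt y⟩)
      (Matrix.of fun k x => F (weight x + k))

theorem rank_coeffMatrix_le {H : Hamiltonian V} (hN : H.IsNatural) (hU : H.IsUnfrustrated)
    (A : Finset V) {ψ : StateSpace V} (hψ : ψ ∈ H.groundSpace) :
    (coeffMatrix A ψ).rank ≤ min A.card Aᶜ.card + 1 := by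
  obtain ⟨N, h⟩ := exists_localOp_mulVec_weight hN hU
  obtain ⟨F, hF⟩ := h ψ hψ
  have h1 : ψ = WithLp.toLp 2
      (localOp N *ᵥ (WithLp.toLp 2 fun x => F (weight x) : StateSpace V)) := by
    rw [← hF]
  rw [h1, coeffMatrix_localOp_mulVec]
  exact (Matrix.rank_mul_le_left _ _).trans
    ((Matrix.rank_mul_le_right _ _).trans (rank_coeffMatrix_weight_le A F))

end SchmidtRank

/-! ### Entropy bounded by the logarithm of the rank. -/

section Entropy

/-- The entropy of a probability vector is at most the logarithm of the size of its support. -/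
theorem neg_sum_mul_logb_le {ι : Type*} [Fintype ι] (p : ι → ℝ) (hp : ∀ i, 0 ≤ p i)
    (hsum : ∑ i, p i = 1) {r : ℕ} (hr : 0 < r) (hcard : Fintype.card {i // p i ≠ 0} ≤ r) :
    -∑ i, p i * Real.logb 2 (p i) ≤ Real.logb 2 r := by
  have hr' : (0 : ℝ) < r := by exact_mod_cast hr
  have h1 : ∀ i, -(p i * Real.log (p i)) ≤
      p i * Real.log r + ((if p i ≠ 0 then (1 : ℝ) / r else 0) - p i) := by
    intro i
    by_cases h : p i = 0
    · simp [h]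
    · have hpos : 0 < p i := lt_of_le_of_ne (hp i) (Ne.symm h)
      -- Gibbs' inequality against the uniform distribution of mass `1/r` per point, termwise.
      have h2 := Real.log_le_sub_one_of_pos (x := 1 / (r * p i)) (by positivity)
      rw [Real.log_div one_ne_zero (by positivity), Real.log_one,
        Real.log_mul hr'.ne' h] at h2
      have h3 := mul_le_mul_of_nonneg_left h2 (hp i)
      have h4 : p i * (1 / (r * p i) - 1) = 1 / r - p i := by field_simp
      rw [if_pos h]
      linarith
  have h2 := Finset.sum_le_sum fun i (_ : i ∈ Finset.univ) => h1 i
  rw [Finset.sum_neg_distrib, Finset.sum_add_distrib, Finset.sum_sub_distrib, ← Finset.sum_mul,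
    hsum, ← Finset.sum_filter, Finset.sum_const, ← Fintype.card_subtype, nsmul_eq_mul] at h2
  have h3 : (Fintype.card {i // p i ≠ 0} : ℝ) * (1 / r) ≤ 1 := by
    rw [mul_one_div, div_le_one hr']
    exact_mod_cast hcard
  have h4 : -∑ i, p i * Real.log (p i) ≤ Real.log r := by linarith
  have hlog : 0 < Real.log 2 := Real.log_pos one_lt_two
  simp only [Real.logb, ← mul_div_assoc, ← Finset.sum_div, ← neg_div]
  gcongr

variable {V : Type*} [Fintype V] [DecidableEq V]

theorem eigenvalues_reducedDensity_nonneg (A : Finset V) (ψ : StateSpace V) (i) :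
    0 ≤ (reducedDensity_isHermitian A ψ).eigenvalues i :=
  (Matrix.posSemidef_self_mul_conjTranspose (coeffMatrix A ψ)).eigenvalues_nonneg i

theorem sum_eigenvalues_reducedDensity (A : Finset V) (ψ : StateSpace V) :
    ∑ i, (reducedDensity_isHermitian A ψ).eigenvalues i = ‖ψ‖ ^ 2 := by
  have h := (reducedDensity_isHermitian A ψ).trace_eq_sum_eigenvalues
  have h2 : (reducedDensity A ψ).trace = ((‖ψ‖ ^ 2 : ℝ) : ℂ) := by
    rw [EuclideanSpace.norm_sq_eq,
      ← (Equiv.piEquivPiSubtypeProd (· ∈ A) (fun _ => Fin 2)).symm.sum_comp,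
      Fintype.sum_prod_type]
    simp only [Matrix.trace, Matrix.diag, reducedDensity, Matrix.mul_apply,
      Matrix.conjTranspose_apply, coeffMatrix]
    push_cast
    refine Finset.sum_congr rfl fun x _ => Finset.sum_congr rfl fun y _ => ?_
    exact Complex.mul_conj' _
  rw [h2] at h
  refine Complex.ofReal_injective (Eq.trans ?_ h.symm)
  exact Complex.ofReal_sum _ _

theorem entanglementEntropy_nonneg (A : Finset V) {ψ : StateSpace V} (hψ : ‖ψ‖ = 1) :
    0 ≤ entanglementEntropy A ψ := by
  have hs := sum_eigenvalues_reducedDensity A ψ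
  rw [hψ, one_pow] at hs
  rw [entanglementEntropy, neg_nonneg]
  refine Finset.sum_nonpos fun i _ => ?_
  have h0 := eigenvalues_reducedDensity_nonneg A ψ i
  refine mul_nonpos_of_nonneg_of_nonpos h0 (Real.logb_nonpos one_lt_two h0 ?_)
  rw [← hs]
  exact Finset.single_le_sum (fun j _ => eigenvalues_reducedDensity_nonneg A ψ j)
    (Finset.mem_univ i)

theorem entanglementEntropy_le_logb (A : Finset V) {ψ : StateSpace V} (hψ : ‖ψ‖ = 1) {r : ℕ}
    (hr : 0 < r) (h : (coeffMatrix A ψ).rank ≤ r) :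
    entanglementEntropy A ψ ≤ Real.logb 2 r := by
  have hs := sum_eigenvalues_reducedDensity A ψ
  rw [hψ, one_pow] at hs
  refine neg_sum_mul_logb_le _ (eigenvalues_reducedDensity_nonneg A ψ) hs hr ?_
  rw [← (reducedDensity_isHermitian A ψ).rank_eq_card_non_zero_eigs]
  exact (Matrix.rank_mul_le_left _ _).trans h

end Entropy

/-! ### Entanglement of formation of the ground state. -/

section Formation

variable {V : Type*} [Fintype V] [DecidableEq V]

theorem embed_isHermitian {a b : V} {h : Matrix (Fin 2 × Fin 2) (Fin 2 × Fin 2) ℂ}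
    (hh : h.IsHermitian) : (embed a b h).IsHermitian := by
  ext x y
  simp only [Matrix.conjTranspose_apply, embed]
  by_cases hxy : ∀ v, v ≠ a → v ≠ b → x v = y v
  · rw [if_pos hxy, if_pos fun v ha hb => (hxy v ha hb).symm, hh.apply]
  · rw [if_neg hxy, if_neg fun hyx => hxy fun v ha hb => (hyx v ha hb).symm, star_zero]

theorem Hamiltonian.op_isHermitian (H : Hamiltonian V) : H.op.IsHermitian := by
  rw [Hamiltonian.op, Matrix.IsHermitian, Matrix.conjTranspose_smul, Matrix.conjTranspose_sum]
  congr 1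
  · simp
  · refine Finset.sum_congr rfl fun a _ => ?_
    rw [Matrix.conjTranspose_sum]
    exact Finset.sum_congr rfl fun b _ => embed_isHermitian (H.posSemidef a b).isHermitian

/-- The lowest eigenvalue is an eigenvalue. -/
theorem Hamiltonian.groundSpace_ne_bot (H : Hamiltonian V) : H.groundSpace ≠ ⊥ := by
  set T := Matrix.toEuclideanLin H.op
  set S := {E : ℝ | Module.End.HasEigenvalue T (E : ℂ)} with hS
  have hfin : S.Finite := by
    have : {μ : ℂ | Module.End.HasEigenvalue T μ}.Finite := Module.End.finite_hasEigenvalue T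
    exact this.preimage Complex.ofReal_injective.injOn
  have hne : S.Nonempty := by
    have hT : T.IsSymmetric := Matrix.isSymmetric_toEuclideanLin_iff.2 H.op_isHermitian
    obtain ⟨μ, hμ⟩ := Module.End.exists_eigenvalue T
    refine ⟨μ.re, ?_⟩
    have : ((μ.re : ℝ) : ℂ) = μ := Complex.conj_eq_iff_re.1 (hT.conj_eigenvalue_eq_self hμ)
    rw [hS, Set.mem_ofPred_eq, this]
    exact hμ
  -- A finite nonempty set of reals contains its infimum.
  exact hne.csInf_mem hfin

/-- The maximally mixed state over the ground space is the uniform mixture of the vectors of an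
orthonormal basis. -/
theorem Hamiltonian.groundState_eq_sum (H : Hamiltonian V) {ι : Type*} [Fintype ι]
    (b : OrthonormalBasis ι ℂ H.groundSpace) :
    H.groundState = ∑ i, ((Module.finrank ℂ H.groundSpace : ℝ)⁻¹ : ℂ) •
      Matrix.vecMulVec (b i : StateSpace V) (star ((b i : StateSpace V) : (V → Fin 2) → ℂ)) := by
  rw [Hamiltonian.groundState, ← Finset.smul_sum]
  simp only [Complex.ofReal_natCast]
  congr 1
  rw [LinearEquiv.symm_apply_eq]
  ext1 v
  rw [b.starProjection_eq_sum_rankOne]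
  ext x
  simp [Matrix.toLpLin_apply, Matrix.vecMulVec_mulVec,
    EuclideanSpace.inner_eq_star_dotProduct, mul_comm, dotProduct_comm]

theorem bddBelow_meanEntropy (A : Finset V) (ρ : Matrix (V → Fin 2) (V → Fin 2) ℂ) :
    BddBelow {E : ℝ | ∃ (m : ℕ) (p : Fin m → ℝ) (ψ : Fin m → StateSpace V),
    (∀ i, 0 ≤ p i) ∧ ∑ i, p i = 1 ∧ (∀ i, ‖ψ i‖ = 1) ∧
    ρ = ∑ i, (p i : ℂ) • Matrix.vecMulVec (ψ i) (star (ψ i : (V → Fin 2) → ℂ)) ∧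
    E = ∑ i, p i * entanglementEntropy A (ψ i)} := by
  refine ⟨0, ?_⟩
  rintro E ⟨m, p, ψ, hp, -, hψ, -, rfl⟩
  exact Finset.sum_nonneg fun i _ => mul_nonneg (hp i) (entanglementEntropy_nonneg A (hψ i))

theorem entanglementOfFormation_groundState_le {H : Hamiltonian V} (hN : H.IsNatural)
    (hU : H.IsUnfrustrated) (A : Finset V) :
    entanglementOfFormation A H.groundState ≤
      Real.logb 2 ((min A.card Aᶜ.card : ℕ) + 1 : ℝ) := by
  set b := stdOrthonormalBasis ℂ H.groundSpace
  have hD : (0 : ℝ) < Module.finrank ℂ H.groundSpace := by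
    have : Nontrivial H.groundSpace :=
      (Submodule.nontrivial_iff_ne_bot).2 H.groundSpace_ne_bot
    exact_mod_cast Module.finrank_pos
  have hnorm : ∀ i, ‖(b i : StateSpace V)‖ = 1 := fun i => by
    rw [Submodule.norm_coe, b.norm_eq_one]
  have hone : ∑ _i : Fin (Module.finrank ℂ H.groundSpace),
      (Module.finrank ℂ H.groundSpace : ℝ)⁻¹ = 1 := by
    simp [hD.ne']
  refine (csInf_le (bddBelow_meanEntropy A _)
    ⟨_, fun _ => (Module.finrank ℂ H.groundSpace : ℝ)⁻¹, fun i => (b i : StateSpace V),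
      fun _ => by positivity, hone, hnorm, ?_, rfl⟩).trans ?_
  · rw [H.groundState_eq_sum b]
    simp
  · rw [← Finset.mul_sum, inv_mul_le_iff₀ hD]
    have h : ∀ i, entanglementEntropy A (b i : StateSpace V) ≤
        Real.logb 2 ((min A.card Aᶜ.card : ℕ) + 1 : ℝ) := fun i => by
      have := entanglementEntropy_le_logb A (hnorm i) (Nat.succ_pos _)
        (rank_coeffMatrix_le hN hU A (b i).2)
      simpa using this
    refine (Finset.sum_le_sum fun i _ => h i).trans ?_
    simp

end Formation

/-! ### Edge isoperimetry in the cubic lattice. -/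

section Isoperimetry

theorem edgeBoundary_compl {V : Type*} [Fintype V] [DecidableEq V] (G : SimpleGraph V)
    (A : Finset V) : edgeBoundary G Aᶜ = edgeBoundary G A := by
  ext e
  simp only [edgeBoundary, Set.mem_ofPred_eq, Finset.mem_compl, not_not]
  constructor
  · rintro ⟨a, ha, b, hb, h, rfl⟩
    exact ⟨b, hb, a, ha, h.symm, Sym2.eq_swap⟩
  · rintro ⟨a, ha, b, hb, h, rfl⟩
    exact ⟨b, hb, a, ha, h.symm, Sym2.eq_swap⟩

/-- A discrete intermediate value argument: if no unit step leaves `Q`, then `Q` spreads from `a` in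
both directions. -/
theorem exists_dist_eq_one_of_not {n : ℕ} (Q : Fin n → Prop) {a b : Fin n} (ha : Q a)
    (hb : ¬ Q b) : ∃ s t : Fin n, Nat.dist s t = 1 ∧ Q s ∧ ¬ Q t := by
  by_contra! hcon
  have up : ∀ k (h : a.1 + k < n), Q ⟨a.1 + k, h⟩ := by
    intro k
    induction k with
    | zero => exact fun _ => ha
    | succ k ih =>
      intro h
      exact hcon ⟨a.1 + k, by omega⟩ _ (by simp [Nat.dist]; omega) (ih (by omega))
  have down : ∀ k, k ≤ a.1 → ∀ h : a.1 - k < n, Q ⟨a.1 - k, h⟩ := by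
    intro k
    induction k with
    | zero => exact fun _ _ => ha
    | succ k ih =>
      intro hk h
      exact hcon ⟨a.1 - k, by omega⟩ _ (by simp [Nat.dist]; omega) (ih (by omega) (by omega))
  apply hb
  rcases le_total a.1 b.1 with h | h
  · have := up (b.1 - a.1) (by omega)
    convert this using 1
    ext
    simp
    omega
  · have := down (a.1 - b.1) (by omega) (by omega)
    convert this using 1
    ext
    simp
    omega

variable {d n : ℕ}

theorem cubicLattice_adj_update (z : Fin d → Fin n) (i : Fin d) {s t : Fin n}
    (h : Nat.dist s t = 1) :
    (cubicLattice d n).Adj (Function.update z i s) (Function.update z i t) := by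
  change ∑ j, Nat.dist _ _ = 1
  rw [Finset.sum_eq_single i]
  · simpa using h
  · intro j _ hj
    simp [hj]
  · simp

/-- A line which meets both a region and its complement contains a boundary edge of the region. -/
theorem exists_mem_edgeBoundary_on_line {A : Finset (Fin d → Fin n)} {z : Fin d → Fin n}
    (hz : z ∈ A) (i : Fin d) {t : Fin n} (ht : Function.update z i t ∉ A) :
    ∃ e ∈ edgeBoundary (cubicLattice d n) A, ∀ u ∈ e, ∀ j, j ≠ i → u j = z j := by
  obtain ⟨s, s', hd, hs, hs'⟩ := exists_dist_eq_one_of_not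
    (fun s => Function.update z i s ∈ A) (a := z i) (by simpa using hz) ht
  refine ⟨s(Function.update z i s, Function.update z i s'),
    ⟨_, hs, _, hs', cubicLattice_adj_update z i hd, rfl⟩, ?_⟩
  intro u hu j hj
  rcases Sym2.mem_iff.1 hu with rfl | rfl <;> simp [hj]

theorem exists_boundaryEdge_choice (A : Finset (Fin d → Fin n)) (i : Fin d) :
    ∃ e : (Fin d → Fin n) → Fin n → Sym2 (Fin d → Fin n), ∀ z t, z ∈ A →
      Function.update z i t ∉ A → e z t ∈ edgeBoundary (cubicLattice d n) A ∧
        ∀ u ∈ e z t, ∀ j, j ≠ i → u j = z j := by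
  classical
  have h : ∀ z t, ∃ e : Sym2 (Fin d → Fin n), z ∈ A → Function.update z i t ∉ A →
      e ∈ edgeBoundary (cubicLattice d n) A ∧ ∀ u ∈ e, ∀ j, j ≠ i → u j = z j := by
    intro z t
    by_cases hz : z ∈ A
    · by_cases ht : Function.update z i t ∉ A
      · obtain ⟨e, h1, h2⟩ := exists_mem_edgeBoundary_on_line hz i ht
        exact ⟨e, fun _ _ => ⟨h1, h2⟩⟩
      · exact ⟨s(z, z), fun _ h => absurd h ht⟩
    · exact ⟨s(z, z), fun h => absurd h hz⟩
  choose e he using h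
  exact ⟨e, he⟩

theorem eq_off_of_edge_eq {i : Fin d} {e : Sym2 (Fin d → Fin n)} {z z' : Fin d → Fin n}
    (h : ∀ u ∈ e, ∀ j, j ≠ i → u j = z j) (h' : ∀ u ∈ e, ∀ j, j ≠ i → u j = z' j) :
    ∀ j, j ≠ i → z j = z' j := by
  intro j hj
  rw [← h _ e.out_fst_mem j hj, h' _ e.out_fst_mem j hj]

theorem card_toFinset_edgeBoundary (A : Finset (Fin d → Fin n))
    [Fintype (edgeBoundary (cubicLattice d n) A)] :
    (edgeBoundary (cubicLattice d n) A).toFinset.card = boundaryArea (cubicLattice d n) A := by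
  rw [boundaryArea, Set.ncard_eq_toFinset_card']

/-- At most `|∂A|` of the lines of a given direction that meet `A` are not contained in `A`. -/
theorem mul_card_image_update_le (A : Finset (Fin d → Fin n)) (i : Fin d) (o : Fin n) :
    n * (A.image fun z => Function.update z i o).card ≤
      n * boundaryArea (cubicLattice d n) A + A.card := by
  classical
  set P := A.image fun z => Function.update z i o with hP
  set F := P.filter fun l => ∀ t, Function.update l i t ∈ A with hF
  have hPo : ∀ l ∈ P, l i = o := by
    intro l hl
    obtain ⟨z, -, rfl⟩ := Finset.mem_image.1 hl
    simp
  -- `P` names each line by its point with `i`-th coordinate `o`. Lines inside `A` are disjoint and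
  -- use `n` points each; every other line yields its own boundary edge.
  have hfull : n * F.card ≤ A.card := by
    have : (Finset.univ ×ˢ F : Finset (Fin n × (Fin d → Fin n))).card ≤ A.card := by
      refine Finset.card_le_card_of_injOn (fun q => Function.update q.2 i q.1) ?_ ?_
      · rintro ⟨t, l⟩ hq
        simp only [Finset.coe_product, Set.mem_prod, Finset.mem_coe, hF, Finset.mem_filter] at hq
        exact hq.2.2 t
      · rintro ⟨t, l⟩ hq ⟨t', l'⟩ hq' h
        simp only [Finset.coe_product, Set.mem_prod, Finset.mem_coe, hF, Finset.mem_filter]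
          at hq hq'
        have ht : t = t' := by simpa using congrFun h i
        refine Prod.ext ht (funext fun j => ?_)
        by_cases hj : j = i
        · subst hj
          exact (hPo l hq.2.1).trans (hPo l' hq'.2.1).symm
        · simpa [hj] using congrFun h j
    simpa [Finset.card_product] using this
  have hmixed : (P.filter fun l => ¬ ∀ t, Function.update l i t ∈ A).card ≤
      boundaryArea (cubicLattice d n) A := by
    have : Nonempty (Sym2 (Fin d → Fin n)) := ⟨s(fun _ => o, fun _ => o)⟩
    have hl : ∀ l ∈ P.filter fun l => ¬ ∀ t, Function.update l i t ∈ A,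
        ∃ g ∈ edgeBoundary (cubicLattice d n) A, ∀ u ∈ g, ∀ j, j ≠ i → u j = l j := by
      intro l hl
      obtain ⟨hlP, hl'⟩ := Finset.mem_filter.1 hl
      push Not at hl'
      obtain ⟨t, ht⟩ := hl'
      obtain ⟨z, hz, rfl⟩ := Finset.mem_image.1 hlP
      rw [Function.update_idem] at ht
      obtain ⟨g, h1, h2⟩ := exists_mem_edgeBoundary_on_line hz i ht
      exact ⟨g, h1, fun u hu j hj => by simp [h2 u hu j hj, hj]⟩
    choose! g hg hgl using hl
    rw [← card_toFinset_edgeBoundary]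
    refine Finset.card_le_card_of_injOn g (fun l hl => by simpa using hg l hl) ?_
    intro l hl l' hl' h
    funext j
    by_cases hj : j = i
    · subst hj
      exact (hPo l (Finset.mem_filter.1 hl).1).trans (hPo l' (Finset.mem_filter.1 hl').1).symm
    · exact eq_off_of_edge_eq (hgl l hl) (h ▸ hgl l' hl') j hj
  have hsplit : F.card + (P.filter fun l => ¬ ∀ t, Function.update l i t ∈ A).card = P.card :=
    Finset.card_filter_add_card_filter_not _
  calc n * P.card = n * F.card + n * _ := by rw [← hsplit, mul_add]
    _ ≤ A.card + n * boundaryArea (cubicLattice d n) A :=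
      add_le_add hfull (Nat.mul_le_mul_left n hmixed)
    _ = _ := add_comm _ _

/-- A Loomis–Whitney type bound: the projections along two distinct directions together determine
the point. -/
theorem card_le_card_image_update_mul (A : Finset (Fin d → Fin n)) {i j : Fin d} (hij : i ≠ j)
    (o : Fin n) :
    A.card ≤ (A.image fun z => Function.update z i o).card *
      (A.image fun z => Function.update z j o).card := by
  rw [← Finset.card_product]
  refine Finset.card_le_card_of_injOn
    (fun z => (Function.update z i o, Function.update z j o)) ?_ ?_
  · intro z hz
    simp only [Finset.coe_product, Set.mem_prod, Finset.mem_coe]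
    exact ⟨Finset.mem_image_of_mem _ hz, Finset.mem_image_of_mem _ hz⟩
  · intro z _ z' _ h
    obtain ⟨h1, h2⟩ := Prod.mk.inj h
    funext k
    by_cases hk : k = i
    · subst hk
      simpa [hij] using congrFun h2 k
    · simpa [hk] using congrFun h1 k

/-- The sites whose first `k` coordinates are those of `y` and the others those of `x`. -/
def hybrid (k : ℕ) (x y : Fin d → Fin n) : Fin d → Fin n :=
  fun j => if j.1 < k then y j else x j

theorem exists_hybrid_crossing {A : Finset (Fin d → Fin n)} {x y : Fin d → Fin n} (hx : x ∈ A)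
    (hy : y ∉ A) :
    ∃ i : Fin d, hybrid i x y ∈ A ∧ Function.update (hybrid i x y) i (y i) ∉ A := by
  by_contra! hcon
  have h : ∀ k, k ≤ d → hybrid k x y ∈ A := by
    intro k
    induction k with
    | zero =>
      intro _
      have h0 : hybrid 0 x y = x := by funext j; simp [hybrid]
      rwa [h0]
    | succ k ih =>
      intro hk
      have := hcon ⟨k, hk⟩ (ih (by omega))
      convert this using 1
      funext j
      by_cases hj : j = ⟨k, hk⟩
      · subst hj
        simp [hybrid]
      · have : j.1 ≠ k := fun h' => hj (Fin.ext h')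
        simp only [hybrid, Function.update_of_ne hj]
        congr 1
        exact propext (by omega)
  apply hy
  have hy' : hybrid d x y = y := by funext j; simp [hybrid]
  exact hy' ▸ h d le_rfl

/-- Each pair in `A ×ˢ Aᶜ` is joined by the route that changes one coordinate at a time. Some leg
leaves `A`, and the count bounds how many pairs share a boundary edge on such a leg. -/
theorem card_mul_card_compl_le (A : Finset (Fin d → Fin n)) :
    A.card * Aᶜ.card ≤ d * (boundaryArea (cubicLattice d n) A * (n * n ^ d)) := by
  classical
  set T : Fin d → Finset ((Fin d → Fin n) × (Fin d → Fin n)) := fun i =>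
    Finset.univ.filter fun q => hybrid i q.1 q.2 ∈ A ∧
      Function.update (hybrid i q.1 q.2) i (q.2 i) ∉ A with hT
  have hcover : A ×ˢ Aᶜ ⊆ Finset.univ.biUnion T := by
    rintro ⟨x, y⟩ hq
    rw [Finset.mem_product, Finset.mem_compl] at hq
    obtain ⟨i, hi⟩ := exists_hybrid_crossing hq.1 hq.2
    exact Finset.mem_biUnion.2 ⟨i, Finset.mem_univ i, by simpa [hT] using hi⟩
  have hcard : ∀ i, (T i).card ≤ boundaryArea (cubicLattice d n) A * (n * n ^ d) := by
    intro i
    obtain ⟨e, he⟩ := exists_boundaryEdge_choice A i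
    have : (T i).card ≤ ((edgeBoundary (cubicLattice d n) A).toFinset ×ˢ
        (Finset.univ : Finset (Fin n × (Fin d → Fin n)))).card := by
      -- The edge gives `hybrid i x y` off coordinate `i`, and the second entry supplies that
      -- coordinate. With the complementary `hybrid i y x`, this recovers both `x` and `y`.
      refine Finset.card_le_card_of_injOn (fun q => (e (hybrid i q.1 q.2) (q.2 i),
        hybrid i q.1 q.2 i, hybrid i q.2 q.1)) ?_ ?_
      · rintro ⟨x, y⟩ hq
        simp only [hT, Finset.coe_filter, Finset.mem_univ, true_and, Set.mem_ofPred_eq] at hq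
        simpa using (he _ _ hq.1 hq.2).1
      · rintro ⟨x, y⟩ hq ⟨x', y'⟩ hq' h
        simp only [hT, Finset.coe_filter, Finset.mem_univ, true_and, Set.mem_ofPred_eq] at hq hq'
        simp only [Prod.mk.injEq] at h
        obtain ⟨h1, h2, h3⟩ := h
        have h4 : hybrid i x y = hybrid i x' y' := by
          funext j
          by_cases hj : j = i
          · subst hj; exact h2
          · exact eq_off_of_edge_eq (he _ _ hq.1 hq.2).2 (h1 ▸ (he _ _ hq'.1 hq'.2).2) j hj
        have h5 : ∀ j, x j = x' j ∧ y j = y' j := by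
          intro j
          have h6 := congrFun h4 j
          have h7 := congrFun h3 j
          by_cases hj : j.1 < i.1
          · simp only [hybrid, if_pos hj] at h6 h7
            exact ⟨h7, h6⟩
          · simp only [hybrid, if_neg hj] at h6 h7
            exact ⟨h6, h7⟩
        exact Prod.ext (funext fun j => (h5 j).1) (funext fun j => (h5 j).2)
    rw [Finset.card_product, card_toFinset_edgeBoundary] at this
    simpa using this
  calc A.card * Aᶜ.card = (A ×ˢ Aᶜ).card := (Finset.card_product _ _).symm
    _ ≤ (Finset.univ.biUnion T).card := Finset.card_le_card hcover
    _ ≤ ∑ i, (T i).card := Finset.card_biUnion_le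
    _ ≤ ∑ _i : Fin d, boundaryArea (cubicLattice d n) A * (n * n ^ d) :=
      Finset.sum_le_sum fun i _ => hcard i
    _ = _ := by simp

/-- Here `p` and `q` count lines in two directions. The bounds give `n√m ≤ nb + m`; if `4b < √m`
this forces `3n < 4√m`, against `2m ≤ n²`. -/
theorem card_le_of_sq_small {m n b p q : ℕ} (hmn : 2 * m ≤ n ^ 2) (hn : 0 < n) (hpq : m ≤ p * q)
    (hp : n * p ≤ n * b + m) (hq : n * q ≤ n * b + m) : m ≤ 16 * b ^ 2 := by
  have h1 : n ^ 2 * m ≤ (n * b + m) ^ 2 := by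
    calc n ^ 2 * m ≤ n ^ 2 * (p * q) := Nat.mul_le_mul_left _ hpq
      _ = (n * p) * (n * q) := by ring
      _ ≤ (n * b + m) * (n * b + m) := Nat.mul_le_mul hp hq
      _ = _ := by ring
  by_contra! hcon
  have hn' : (0 : ℝ) < n := by exact_mod_cast hn
  have h1' : (n : ℝ) ^ 2 * m ≤ (n * b + m) ^ 2 := by exact_mod_cast h1
  have hcon' : (16 : ℝ) * b ^ 2 < m := by exact_mod_cast hcon
  have hmn' : (2 : ℝ) * m ≤ n ^ 2 := by exact_mod_cast hmn
  set s := Real.sqrt m with hs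
  have hs2 : s ^ 2 = m := Real.sq_sqrt (by positivity)
  have hm : (0 : ℝ) < m := lt_of_le_of_lt (by positivity) hcon'
  have hs0 : 0 < s := Real.sqrt_pos.2 hm
  rw [← hs2] at h1' hcon' hmn'
  have h2 : (n : ℝ) * s ≤ n * b + s ^ 2 := by
    rw [← pow_le_pow_iff_left₀ (by positivity) (by positivity) two_ne_zero, mul_pow]
    exact h1'
  have h3 : 4 * (b : ℝ) < s := by
    refine lt_of_pow_lt_pow_left₀ 2 hs0.le ?_
    nlinarith
  have h4 : 3 * (n : ℝ) < 4 * s := by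
    by_contra! h
    nlinarith
  nlinarith

theorem card_le_mul_boundaryArea_sq (hd : 2 ≤ d) (A : Finset (Fin d → Fin n))
    (hA : A.card ≤ Aᶜ.card) :
    A.card ≤ 9 * d ^ 2 * boundaryArea (cubicLattice d n) A ^ 2 := by
  rcases A.eq_empty_or_nonempty with rfl | ⟨z, hz⟩
  · simp
  set b := boundaryArea (cubicLattice d n) A with hb
  have o : Fin n := z ⟨0, by omega⟩
  have hn : 0 < n := o.pos
  have hm : 0 < A.card := Finset.card_pos.2 ⟨z, hz⟩
  -- Below this threshold projections give `16 b²`. Above it, route counting gives `|A| ≤ 2dnb`, and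
  -- `n² < 2|A|` then yields `8d²b²`. The constant `9d²` covers both, as `d ≥ 2`, and is the square
  -- of `3d`.
  by_cases hmn : 2 * A.card ≤ n ^ 2
  · have h := card_le_of_sq_small hmn hn
      (card_le_card_image_update_mul A (i := ⟨0, by omega⟩) (j := ⟨1, by omega⟩) (by simp) o)
      (mul_card_image_update_le A _ o) (mul_card_image_update_le A _ o)
    refine h.trans (Nat.mul_le_mul_right _ ?_)
    nlinarith
  · push Not at hmn
    have hsum : A.card + Aᶜ.card = n ^ d := by
      rw [Finset.card_add_card_compl]
      simp
    have h1 := card_mul_card_compl_le A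
    rw [← hb] at h1
    have hnd : 0 < n ^ d := by positivity
    have h2 : A.card ≤ 2 * d * n * b := by
      refine Nat.le_of_mul_le_mul_right ?_ hnd
      calc A.card * n ^ d ≤ A.card * (2 * Aᶜ.card) := Nat.mul_le_mul_left _ (by omega)
        _ = 2 * (A.card * Aᶜ.card) := by ring
        _ ≤ 2 * (d * (b * (n * n ^ d))) := Nat.mul_le_mul_left _ h1
        _ = _ := by ring
    refine Nat.le_of_mul_le_mul_right ?_ hm
    calc A.card * A.card ≤ (2 * d * n * b) * (2 * d * n * b) := Nat.mul_le_mul h2 h2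
      _ = 4 * d ^ 2 * b ^ 2 * n ^ 2 := by ring
      _ ≤ 4 * d ^ 2 * b ^ 2 * (2 * A.card) := Nat.mul_le_mul_left _ hmn.le
      _ = 8 * d ^ 2 * b ^ 2 * A.card := by ring
      _ ≤ 9 * d ^ 2 * b ^ 2 * A.card := by gcongr; norm_num

/-- The edge boundary of a region of the cubic lattice grows at least like the square root of
its size. -/
theorem hasBoundaryGrowth_cubicLattice (hd : 2 ≤ d) (n : ℕ) :
    HasBoundaryGrowth (cubicLattice d n) (1 / 2) (1 / (3 * d)) := by
  intro A _
  have key : min A.card Aᶜ.card ≤ 9 * d ^ 2 * boundaryArea (cubicLattice d n) A ^ 2 := by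
    rcases le_total A.card Aᶜ.card with h | h
    · rw [min_eq_left h]
      exact card_le_mul_boundaryArea_sq hd A h
    · rw [min_eq_right h]
      have := card_le_mul_boundaryArea_sq hd Aᶜ (by rwa [compl_compl])
      rwa [boundaryArea, edgeBoundary_compl] at this
  have hd' : (0 : ℝ) < d := by exact_mod_cast (by omega : 0 < d)
  rw [← Real.sqrt_eq_rpow, one_div_mul_eq_div, div_le_iff₀ (by positivity)]
  refine Real.sqrt_le_iff.2 ⟨by positivity, ?_⟩
  have key' : ((min A.card Aᶜ.card : ℕ) : ℝ) ≤
      9 * d ^ 2 * boundaryArea (cubicLattice d n) A ^ 2 := by exact_mod_cast key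
  refine key'.trans (le_of_eq ?_)
  ring

end Isoperimetry

/-! ### From boundary growth to the logarithm law. -/

section LogarithmLaw

/-- Growth gives `m ≤ (b/K)^(1/c)`, and `b^(1/c) ≥ 1` absorbs the added 1. -/
theorem logb_add_one_le_of_rpow_le {c K : ℝ} (hc : 0 < c) (hK : 0 < K) {m b : ℕ} (hb : 1 ≤ b)
    (h : K * (m : ℝ) ^ c ≤ b) :
    Real.logb 2 (m + 1) ≤ Real.logb 2 (1 + (1 / K) ^ (1 / c)) + 1 / c * Real.logb 2 b := by
  have hb' : (1 : ℝ) ≤ b := by exact_mod_cast hb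
  have hb0 : (0 : ℝ) < b := by linarith
  have hbc : 1 ≤ (b : ℝ) ^ (1 / c) := Real.one_le_rpow hb' (by positivity)
  have h1 : (m : ℝ) ≤ (1 / K) ^ (1 / c) * (b : ℝ) ^ (1 / c) := by
    rw [← Real.mul_rpow (by positivity) hb0.le]
    have h2 : (m : ℝ) ^ c ≤ 1 / K * b := by
      rw [one_div_mul_eq_div, le_div_iff₀ hK]
      linarith
    calc (m : ℝ) = ((m : ℝ) ^ c) ^ (1 / c) := by
          rw [← Real.rpow_mul (by positivity), mul_one_div_cancel hc.ne', Real.rpow_one]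
      _ ≤ _ := Real.rpow_le_rpow (by positivity) h2 (by positivity)
  have hpos : (0 : ℝ) < 1 + (1 / K) ^ (1 / c) := by positivity
  rw [← Real.logb_rpow_eq_mul_logb_of_pos hb0, ← Real.logb_mul hpos.ne' (by positivity)]
  refine Real.logb_le_logb_of_le one_lt_two (by positivity) ?_
  nlinarith

theorem logarithm_law {c K : ℝ} (hc : 0 < c) (hK : 0 < K) : ∃ C : ℝ, 0 < C ∧
    ∀ (V : Type*) [Fintype V] [DecidableEq V] (H : Hamiltonian V),
      HasBoundaryGrowth H.interactionGraph c K → H.IsNatural → H.IsUnfrustrated →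
      ∀ A : Finset V, IsContiguous H.interactionGraph A →
        (2 ≤ boundaryArea H.interactionGraph A →
          entanglementOfFormation A H.groundState ≤
            C * Real.logb 2 (boundaryArea H.interactionGraph A)) ∧
        entanglementOfFormation A H.groundState ≤
          C * Real.logb 2 (boundaryArea H.interactionGraph A + 1) := by
  set L := Real.logb 2 (1 + (1 / K) ^ (1 / c)) with hL
  have hL0 : 0 ≤ L := Real.logb_nonneg one_lt_two (by
    have : 0 ≤ (1 / K) ^ (1 / c) := by positivity
    linarith)
  have hc' : 0 < 1 / c := by positivity
  -- The additive `L` is absorbed because `logb 2 b ≥ 1` for `b ≥ 2`, and `logb 2 (b + 1) ≥ 1` for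
  -- `b ≥ 1`. If `b = 0`, growth forces `m = 0` and the entropy bound is `logb 2 1 = 0`.
  refine ⟨L + 1 / c, by positivity, ?_⟩
  intro V _ _ H hG hN hU A hA
  have hE := entanglementOfFormation_groundState_le hN hU A
  have hgrowth := hG A hA
  generalize min A.card Aᶜ.card = m at hE hgrowth
  generalize boundaryArea H.interactionGraph A = b at hgrowth
  constructor
  · intro hb
    refine hE.trans ((logb_add_one_le_of_rpow_le hc hK (by omega) hgrowth).trans ?_)
    have h1 : 1 ≤ Real.logb 2 b := by
      rw [Real.le_logb_iff_rpow_le one_lt_two (by positivity), Real.rpow_one]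
      exact_mod_cast hb
    nlinarith
  · rcases Nat.eq_zero_or_pos b with rfl | hb
    · have hm : m = 0 := by
        by_contra hm
        have : (0 : ℝ) < m := by exact_mod_cast Nat.pos_of_ne_zero hm
        have h2 : 0 < K * (m : ℝ) ^ c := by positivity
        rw [Nat.cast_zero] at hgrowth
        linarith
      subst hm
      simpa using hE
    · refine hE.trans ((logb_add_one_le_of_rpow_le hc hK hb hgrowth).trans ?_)
      have hb' : (1 : ℝ) ≤ b := by exact_mod_cast hb
      have h1 : 1 ≤ Real.logb 2 ((b : ℝ) + 1) := by
        rw [Real.le_logb_iff_rpow_le one_lt_two (by positivity), Real.rpow_one]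
        linarith
      have h2 : Real.logb 2 b ≤ Real.logb 2 ((b : ℝ) + 1) :=
        Real.logb_le_logb_of_le one_lt_two (by positivity) (by linarith)
      have h3 := mul_le_mul_of_nonneg_left h2 hc'.le
      nlinarith

end LogarithmLaw

end SpinLattice

end

theorem mainTheorem2 :
    (∀ c K : ℝ, 0 < c → 0 < K → ∃ C : ℝ, 0 < C ∧
      ∀ (V : Type*) [Fintype V] [DecidableEq V] (H : SpinLattice.Hamiltonian V),
        SpinLattice.HasBoundaryGrowth H.interactionGraph c K →
        H.IsNatural → H.IsUnfrustrated →
        ∀ A : Finset V, SpinLattice.IsContiguous H.interactionGraph A →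
          (2 ≤ SpinLattice.boundaryArea H.interactionGraph A →
            SpinLattice.entanglementOfFormation A H.groundState ≤
              C * Real.logb 2 (SpinLattice.boundaryArea H.interactionGraph A)) ∧
          SpinLattice.entanglementOfFormation A H.groundState ≤
            C * Real.logb 2 (SpinLattice.boundaryArea H.interactionGraph A + 1)) ∧
    (∀ d : ℕ, 2 ≤ d → ∃ C : ℝ, 0 < C ∧
      ∀ (n : ℕ) (H : SpinLattice.Hamiltonian (Fin d → Fin n)),
        H.interactionGraph = SpinLattice.cubicLattice d n →
        H.IsNatural → H.IsUnfrustrated →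
        ∀ A : Finset (Fin d → Fin n), SpinLattice.IsContiguous H.interactionGraph A →
          (2 ≤ SpinLattice.boundaryArea H.interactionGraph A →
            SpinLattice.entanglementOfFormation A H.groundState ≤
              C * Real.logb 2 (SpinLattice.boundaryArea H.interactionGraph A)) ∧
          SpinLattice.entanglementOfFormation A H.groundState ≤
            C * Real.logb 2 (SpinLattice.boundaryArea H.interactionGraph A + 1)) := by
  refine ⟨fun c K hc hK => SpinLattice.logarithm_law hc hK, fun d hd => ?_⟩
  have hd' : (0 : ℝ) < d := by exact_mod_cast (by omega : 0 < d)
  obtain ⟨C, hC, h⟩ := SpinLattice.logarithm_law.{0} (c := 1 / 2) (K := 1 / (3 * d))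
    (by norm_num) (by positivity)
  refine ⟨C, hC, fun n H hH => h _ H ?_⟩
  rw [hH]
  exact SpinLattice.hasBoundaryGrowth_cubicLattice hd n
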